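/- Let $\mathbb{F}_q$ be a finite field with $q\equiv 1 \pmod 3$, let $t\in\mathbb{F}_q$ be a quadratic non-residue (so $q$ is odd), let $b_0\in\mathbb{F}_q$ be a non-cube, and let $\rho\in\mathbb{F}_q$ be a primitive cube root of unity. A rational subgroup of order three of an elliptic curve $E/\mathbb{F}_q$ is a subgroup of order $3$ of $E(\overline{\mathbb{F}}_q)$ that is stable under the $q$-Frobenius. Isomorphism means isomorphism over $\mathbb{F}_q$. Let $\mathcal{C}$ be the collection of elliptic curves over $\mathbb{F}_q$ that have exactly one rational subgroup of order three and for which the nonzero points of this subgroup are defined over $\mathbb{F}_{q^2}$ but not over $\mathbb{F}_q$. Then there are exactly $(2q+4)/3$ isomorphism classes of curves in $\mathcal{C}$. For $i\in\{0,1,2\}$ and $a\in\mathbb{F}_q$ such that $a^3-27b_0^i$ is not a cube in $\mathbb{F}_q$, put $$A_{i,a}=-\frac{a(a^3-24b_0^i)}{48},\qquad B_{i,a}=\frac{b_0^{2i}}{4}+\frac{a^6}{864}-\frac{a^3b_0^i}{24},$$ $$E_{i,a}:\ y^2=x^3+t^2A_{i,a}\,x+t^3B_{i,a}.$$ 1.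 The curve $y^2+axy+b_0^iy=x^3$ is an elliptic curve whose group of $\mathbb{F}_q$-rational $3$-torsion points is cyclic of order $3$; it is isomorphic to $y^2=x^3+A_{i,a}x+B_{i,a}$, and its quadratic twist $E_{i,a}$ is an elliptic curve in $\mathcal{C}$. 2. $E_{i,a}\cong E_{j,a'}$ if and only if $i=j$ and $a'\in\{a,\rho a,\rho^2a\}$. 3. The $E_{i,a}$ represent all classes: if one element $m_a$ is chosen in each set $\{a,\rho a,\rho^2 a\}$ (depending only on the set), then every curve in $\mathcal{C}$ is isomorphic to $E_{i,a}$ for exactly one pair $(i,a)$ as above with $a=m_a$. -/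

import Mathlib

open scoped WeierstrassCurve.Affine

noncomputable section

namespace WeierstrassCurve

section Rational

variable {F : Type*} [Field F]

/-- Two elliptic curves over `F`, given by Weierstrass equations, are isomorphic over `F` when an
admissible change of variables with coefficients in `F` takes one equation to the other. -/
def IsIsomorphicOver (E E' : WeierstrassCurve F) : Prop :=
  ∃ C : VariableChange F, C • E = E'

/-- The points of `E` over an algebraic closure of `F`. -/
abbrev GeomPoint (E : WeierstrassCurve F) : Type _ :=
  (E⁄(AlgebraicClosure F)).Point

open Classical in
/-- The Frobenius `(x, y) ↦ (x ^ q, y ^ q)` on the geometric points of a curve over `F = 𝔽_q`. -/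
def frobeniusPoint [Fintype F] (E : WeierstrassCurve F) (P : E.GeomPoint) : E.GeomPoint :=
  Affine.Point.map (FiniteField.frobeniusAlgHom F (AlgebraicClosure F)) P

/-- The geometric point `P` of a curve over `F = 𝔽_q` is defined over `𝔽_{q ^ n}`, the subfield
`{z | z ^ (q ^ n) = z}` of the algebraic closure. -/
def IsDefinedOver [Fintype F] (E : WeierstrassCurve F) (n : ℕ) : E.GeomPoint → Prop
  | .zero => True
  | .some x y _ => x ^ (Fintype.card F ^ n) = x ∧ y ^ (Fintype.card F ^ n) = y

open Classical in
/-- `G` is a rational subgroup of order three: a subgroup of order three of the group of geometric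
points that is carried to itself by the Frobenius. -/
def IsRationalSubgroupOfOrderThree [Fintype F] (E : WeierstrassCurve F)
    (G : AddSubgroup E.GeomPoint) : Prop :=
  Nat.card G = 3 ∧ ∀ P ∈ G, E.frobeniusPoint P ∈ G

open Classical in
/-- `E` has exactly one rational subgroup of order three, and the nonzero points of that subgroup
are defined over `𝔽_{q ^ 2}` but not over `𝔽_q`. -/
def HasOnlyQuadraticThreeSubgroup [Fintype F] (E : WeierstrassCurve F) : Prop :=
  ∃ G : AddSubgroup E.GeomPoint,
    E.IsRationalSubgroupOfOrderThree G ∧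
    (∀ H : AddSubgroup E.GeomPoint, E.IsRationalSubgroupOfOrderThree H → H = G) ∧
    ∀ P ∈ G, P ≠ 0 → E.IsDefinedOver 2 P ∧ ¬ E.IsDefinedOver 1 P

open Classical in
/-- The group of `F`-rational points of `E` killed by `3`. -/
def rationalThreeTorsion (E : WeierstrassCurve F) : AddSubgroup E.toAffine.Point :=
  AddSubgroup.torsionBy E.toAffine.Point 3

end Rational

/-- The elliptic curves over `F` with exactly one rational subgroup of order three, whose nonzero
points are defined over `𝔽_{q ^ 2}` but not over `𝔽_q`. -/
def QuadraticThreeSubgroupCurve (F : Type*) [Field F] [Fintype F] : Type _ :=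
  {E : WeierstrassCurve F // E.IsElliptic ∧ E.HasOnlyQuadraticThreeSubgroup}

/-- Isomorphism over `F` of these elliptic curves. -/
instance quadraticThreeSubgroupCurveSetoid (F : Type*) [Field F] [Fintype F] :
    Setoid (QuadraticThreeSubgroupCurve F) where
  r E E' := IsIsomorphicOver E.1 E'.1
  iseqv :=
    { refl := fun _ => ⟨1, one_smul _ _⟩
      symm := by
        rintro _ _ ⟨C, hC⟩
        exact ⟨C⁻¹, by rw [← hC, inv_smul_smul]⟩
      trans := by
        rintro _ _ _ ⟨C, hC⟩ ⟨D, hD⟩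
        exact ⟨D * C, by rw [mul_smul, hC, hD]⟩ }

section Families

variable {F : Type*} [Field F]

/-- The curve `y² + a x y + b y = x³`. -/
def threePointCurve (a b : F) : WeierstrassCurve F :=
  { a₁ := a, a₂ := 0, a₃ := b, a₄ := 0, a₆ := 0 }

/-- The curve `y² = x³ + A x + B`. -/
def shortCurve (A B : F) : WeierstrassCurve F :=
  { a₁ := 0, a₂ := 0, a₃ := 0, a₄ := A, a₆ := B }

/-- `A_{a,b} = -a (a³ - 24 b) / 48`. -/
def coeffA (a b : F) : F := -(a * (a ^ 3 - 24 * b)) / 48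

/-- `B_{a,b} = b² / 4 + a⁶ / 864 - a³ b / 24`. -/
def coeffB (a b : F) : F := b ^ 2 / 4 + a ^ 6 / 864 - a ^ 3 * b / 24

/-- The twist by `t`, namely `y² = x³ + t² A_{a,b} x + t³ B_{a,b}`. -/
def twistedCurve (t a b : F) : WeierstrassCurve F :=
  shortCurve (t ^ 2 * coeffA a b) (t ^ 3 * coeffB a b)

end Families

end WeierstrassCurve

end

/-! A subgroup of order three is `{0, P, -P}`, so it is determined by `x(P)`, a root of the division
polynomial `Ψ₃`. It is Frobenius-stable exactly when `x(P)` lies in `F`, and its points are then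
rational exactly when `Ψ₂Sq`, the square of `2y + a₁x + a₃`, takes a square value there. Membership
in the class therefore means that `Ψ₃` has a single root `x₀` in `F`, with a nonsquare value of
`Ψ₂Sq` (`hasOnlyQuadraticThreeSubgroup_iff`). Moving `x₀` to `0` puts the curve in the form `y² = x³
+ t(ax + tb)²/4`. The other roots `x` of `Ψ₃` correspond under `c = a + 3bt/x` to the solutions of
`c³ = a³ - 27b`, so uniqueness says that `a³ - 27b` is not a cube. An isomorphism between two such
models fixes the root `0` and hence is a scaling `(a, b) ↦ (wa, w³b)`. Thus `b` matters modulo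
cubes, which gives the index `i`, and `a` up to cube roots of unity. For the count, `a = 0` leaves
`i = 1, 2`. For `a ≠ 0` the map `(i, a) ↦ 1 - 27b₀^i/a³` is a bijection from classes to non-cubes,
of which there are `2(q - 1)/3`. -/

namespace WeierstrassCurve

/-! ### Division polynomials and 3-torsion. -/

section DivisionPolynomials

variable {K : Type*} [Field K]

lemma eval_Ψ₃ (W : WeierstrassCurve K) (x : K) :
    W.Ψ₃.eval x = 3 * x ^ 4 + W.b₂ * x ^ 3 + 3 * W.b₄ * x ^ 2 + 3 * W.b₆ * x + W.b₈ := by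
  simp [Ψ₃]

lemma eval_Ψ₂Sq (W : WeierstrassCurve K) (x : K) :
    W.Ψ₂Sq.eval x = 4 * x ^ 3 + W.b₂ * x ^ 2 + 2 * W.b₄ * x + W.b₆ := by
  simp [Ψ₂Sq]

lemma eval_Ψ₂Sq_eq_sq {W : WeierstrassCurve K} {x y : K} (h : W.toAffine.Equation x y) :
    W.Ψ₂Sq.eval x = (2 * y + W.a₁ * x + W.a₃) ^ 2 := by
  rw [Affine.equation_iff] at h
  rw [eval_Ψ₂Sq, b₂, b₄, b₆]
  linear_combination -4 * h

/-- With `D = 2y + a₁x + a₃` and `N` the numerator of the tangent slope, the right side is `D² (x(P)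
- x(2P))` after clearing denominators. -/
lemma eval_Ψ₃_eq {W : WeierstrassCurve K} {x y : K} (h : W.toAffine.Equation x y) :
    W.Ψ₃.eval x = (3 * x + W.a₂) * (2 * y + W.a₁ * x + W.a₃) ^ 2
      - W.a₁ * (3 * x ^ 2 + 2 * W.a₂ * x + W.a₄ - W.a₁ * y) * (2 * y + W.a₁ * x + W.a₃)
      - (3 * x ^ 2 + 2 * W.a₂ * x + W.a₄ - W.a₁ * y) ^ 2 := by
  rw [Affine.equation_iff] at h
  rw [eval_Ψ₃, b₂, b₄, b₆, b₈]
  linear_combination (-12 * x - 4 * W.a₂ - W.a₁ ^ 2) * h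

lemma eval_Ψ₃_ne_zero_of_Y_eq {W : WeierstrassCurve K} {x y : K} (h : W.toAffine.Nonsingular x y)
    (hy : y = W.toAffine.negY x y) : W.Ψ₃.eval x ≠ 0 := by
  have hD : 2 * y + W.a₁ * x + W.a₃ = 0 := by
    rw [Affine.negY] at hy
    linear_combination hy
  rw [eval_Ψ₃_eq h.1, hD]
  have := ((W.toAffine.nonsingular_iff' x y).1 h).2
  rw [hD] at this
  have hN : 3 * x ^ 2 + 2 * W.a₂ * x + W.a₄ - W.a₁ * y ≠ 0 := by
    rcases this with h1 | h1
    · intro h2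
      exact h1 (by linear_combination -h2)
    · exact absurd rfl h1
  simpa using hN

/-- If `x(2P) = x(P)` then `2P = ±P`, and `2P = P` would force `P = 0`. At a 2-torsion point both
sides fail, since `Ψ₃` is there minus the square of a slope numerator that is nonzero by
nonsingularity. -/
lemma Affine.Point.add_self_eq_neg_iff [DecidableEq K] {W : WeierstrassCurve K} {x y : K}
    (h : W.toAffine.Nonsingular x y) :
    Affine.Point.some x y h + Affine.Point.some x y h = -Affine.Point.some x y h ↔
      W.Ψ₃.eval x = 0 := by
  by_cases hy : y = W.toAffine.negY x y
  · rw [Affine.Point.add_self_of_Y_eq hy]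
    refine iff_of_false (fun h0 => ?_) (eval_Ψ₃_ne_zero_of_Y_eq h hy)
    exact Affine.Point.some_ne_zero h (neg_eq_zero.1 h0.symm)
  · have hD : 2 * y + W.a₁ * x + W.a₃ ≠ 0 := fun h0 => hy (by
      rw [Affine.negY]
      linear_combination h0)
    have key : W.toAffine.addX x x (W.toAffine.slope x x y y) = x ↔ W.Ψ₃.eval x = 0 := by
      have hD' : y - W.toAffine.negY x y = 2 * y + W.a₁ * x + W.a₃ := by
        rw [Affine.negY]
        ring
      have hslope := Affine.slope_of_Y_ne (W := W.toAffine) (x₁ := x) rfl hy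
      rw [hD', eq_div_iff hD] at hslope
      rw [eval_Ψ₃_eq h.1, Affine.addX]
      generalize W.toAffine.slope x x y y = m at hslope
      rw [← hslope]
      constructor
      · intro h0
        linear_combination -(2 * y + W.a₁ * x + W.a₃) ^ 2 * h0
      · intro h0
        refine mul_left_cancel₀ (pow_ne_zero 2 hD) ?_
        linear_combination -h0
    rw [← key, Affine.Point.add_self_of_Y_ne hy]
    constructor
    · intro h0
      rw [Affine.Point.neg_some] at h0
      exact (Affine.Point.some.inj h0).1
    · intro h0
      rcases (Affine.Point.X_eq_iff (h₁ := Affine.nonsingular_add h h fun hxy => hy hxy.2)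
        (h₂ := h)).1 h0 with h1 | h1
      · rw [← Affine.Point.add_self_of_Y_ne (h₁ := h) hy] at h1
        exact absurd (add_eq_left.1 h1) (Affine.Point.some_ne_zero _)
      · exact h1

lemma Affine.Point.three_nsmul_eq_zero_iff [DecidableEq K] {W : WeierstrassCurve K} {x y : K}
    (h : W.toAffine.Nonsingular x y) :
    3 • Affine.Point.some x y h = 0 ↔ W.Ψ₃.eval x = 0 := by
  rw [← Affine.Point.add_self_eq_neg_iff h, succ_nsmul, two_nsmul, add_eq_zero_iff_eq_neg]

end DivisionPolynomials

/-! ### Subgroups of order three in an additive group. -/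

section SubgroupsOfOrderThree

variable {A : Type*} [AddGroup A]

lemma mem_zmultiples_of_three_nsmul {P Q : A} (hP : 3 • P = 0)
    (hQ : Q ∈ AddSubgroup.zmultiples P) : Q = 0 ∨ Q = P ∨ Q = -P := by
  obtain ⟨n, rfl⟩ := AddSubgroup.mem_zmultiples_iff.1 hQ
  have h3 : (3 : ℤ) • P = 0 := by exact_mod_cast hP
  rw [← Int.emod_add_mul_ediv n 3, add_zsmul, mul_comm, mul_zsmul, h3, zsmul_zero, add_zero]
  have h0 := Int.emod_nonneg n (b := 3) (by norm_num)
  have h1 := Int.emod_lt_of_pos n (b := 3) (by norm_num)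
  interval_cases n % 3
  · exact Or.inl (zero_zsmul P)
  · exact Or.inr (Or.inl (one_zsmul P))
  · refine Or.inr (Or.inr (eq_neg_of_add_eq_zero_left ?_))
    rw [← h3, show (3 : ℤ) = 2 + 1 by norm_num, add_zsmul, one_zsmul]

lemma natCard_zmultiples_of_three_nsmul {P : A} (hP : 3 • P = 0) (h0 : P ≠ 0) :
    Nat.card (AddSubgroup.zmultiples P) = 3 := by
  rw [Nat.card_zmultiples]
  exact addOrderOf_eq_prime hP h0

lemma eq_zmultiples_of_natCard_eq_three {G : AddSubgroup A} (hG : Nat.card G = 3) {P : A}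
    (hP : P ∈ G) (h0 : P ≠ 0) : 3 • P = 0 ∧ G = AddSubgroup.zmultiples P := by
  have h3 : 3 • P = 0 := by
    have := card_nsmul_eq_zero' (x := (⟨P, hP⟩ : G))
    rw [hG] at this
    simpa using congrArg Subtype.val this
  refine ⟨h3, ?_⟩
  have hfin : Finite G := Nat.finite_of_card_ne_zero (by rw [hG]; norm_num)
  symm
  refine AddSubgroup.eq_of_le_of_card_ge ((AddSubgroup.zmultiples_le_of_mem) hP) ?_
  rw [hG, natCard_zmultiples_of_three_nsmul h3 h0]

end SubgroupsOfOrderThree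

end WeierstrassCurve

/-- The image of `F` already supplies `q` roots of `X^q - X`, which has at most `q`. -/
lemma FiniteField.exists_algebraMap_eq_of_pow_card_eq {F K : Type*} [Field F] [Fintype F] [Field K]
    [Algebra F K] {z : K} (hz : z ^ Fintype.card F = z) : ∃ x : F, algebraMap F K x = z := by
  classical
  have hq : 1 < Fintype.card F := Fintype.one_lt_card
  have h0 := FiniteField.X_pow_card_sub_X_ne_zero K hq
  have hsub : Finset.univ.image (algebraMap F K) ⊆
      (Polynomial.X ^ Fintype.card F - Polynomial.X : Polynomial K).roots.toFinset := by
    intro w hw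
    obtain ⟨x, -, rfl⟩ := Finset.mem_image.1 hw
    simp [h0, ← map_pow, FiniteField.pow_card]
  have hcard : (Polynomial.X ^ Fintype.card F - Polynomial.X : Polynomial K).roots.toFinset.card ≤
      (Finset.univ.image (algebraMap F K)).card := by
    rw [Finset.card_image_of_injective _ (algebraMap F K).injective, Finset.card_univ]
    calc _ ≤ _ := Multiset.toFinset_card_le _
      _ ≤ _ := Polynomial.card_roots' _
      _ = _ := FiniteField.X_pow_card_sub_X_natDegree_eq K hq
  have hmem : z ∈ Finset.univ.image (algebraMap F K) := by
    rw [Finset.eq_of_subset_of_card_le hsub hcard]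
    simp [h0, hz]
  obtain ⟨x, -, hx⟩ := Finset.mem_image.1 hmem
  exact ⟨x, hx⟩

namespace WeierstrassCurve

/-! ### Rational subgroups of order three as roots of `Ψ₃` in `F`. -/

section RationalSubgroups

variable {F : Type*} [Field F]

/-- `x₀` is the only root of the third division polynomial of `E`, and the points with
`x`-coordinate `x₀` are not rational. -/
def IsUniqueNonsquareRoot (E : WeierstrassCurve F) (x₀ : F) : Prop :=
  E.Ψ₃.eval x₀ = 0 ∧ ¬ IsSquare (E.Ψ₂Sq.eval x₀) ∧ ∀ x, E.Ψ₃.eval x = 0 → x = x₀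

lemma eval_Ψ₃_baseChange {K : Type*} [Field K] [Algebra F K] (E : WeierstrassCurve F) (x : F) :
    (E⁄K).Ψ₃.eval (algebraMap F K x) = algebraMap F K (E.Ψ₃.eval x) := by
  change (E.map (algebraMap F K)).Ψ₃.eval _ = _
  rw [map_Ψ₃, Polynomial.eval_map, Polynomial.eval₂_at_apply]

lemma eval_Ψ₂Sq_baseChange {K : Type*} [Field K] [Algebra F K] (E : WeierstrassCurve F) (x : F) :
    (E⁄K).Ψ₂Sq.eval (algebraMap F K x) = algebraMap F K (E.Ψ₂Sq.eval x) := by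
  change (E.map (algebraMap F K)).Ψ₂Sq.eval _ = _
  rw [map_Ψ₂Sq, Polynomial.eval_map, Polynomial.eval₂_at_apply]

lemma exists_equation_of_isAlgClosed {K : Type*} [Field K] [IsAlgClosed K] (h2 : (2 : K) ≠ 0)
    (W : WeierstrassCurve K) (x : K) : ∃ y, W.toAffine.Equation x y := by
  obtain ⟨w, hw⟩ := IsAlgClosed.exists_pow_nat_eq (W.Ψ₂Sq.eval x) (n := 2) (by norm_num)
  refine ⟨(w - W.a₁ * x - W.a₃) / 2, ?_⟩
  rw [eval_Ψ₂Sq, b₂, b₄, b₆] at hw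
  rw [Affine.equation_iff]
  field_simp
  linear_combination hw

variable [Fintype F] {E : WeierstrassCurve F}

lemma frobeniusPoint_zero : E.frobeniusPoint 0 = 0 :=
  rfl

lemma frobeniusPoint_some {x y : AlgebraicClosure F}
    (h : (E⁄(AlgebraicClosure F)).Nonsingular x y) :
    ∃ h', E.frobeniusPoint (.some x y h) =
      .some (x ^ Fintype.card F) (y ^ Fintype.card F) h' :=
  ⟨_, rfl⟩

open Classical in
lemma frobeniusPoint_neg (P : E.GeomPoint) : E.frobeniusPoint (-P) = -E.frobeniusPoint P :=
  map_neg (Affine.Point.map (W' := E) (FiniteField.frobeniusAlgHom F (AlgebraicClosure F))) P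

open Classical in
lemma frobeniusPoint_eq_or_eq_neg {x : F} {y : AlgebraicClosure F}
    (h : (E⁄(AlgebraicClosure F)).Nonsingular (algebraMap F _ x) y) :
    E.frobeniusPoint (.some _ y h) = .some _ y h ∨
      E.frobeniusPoint (.some _ y h) = -.some _ y h := by
  obtain ⟨h', hP⟩ := frobeniusPoint_some h
  rw [hP]
  refine Affine.Point.X_eq_iff.1 ?_
  rw [← map_pow, FiniteField.pow_card]

lemma isDefinedOver_neg {n : ℕ} {P : E.GeomPoint} (hP : E.IsDefinedOver n P) :
    E.IsDefinedOver n (-P) := by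
  cases P with
  | zero => trivial
  | some x y h =>
    rw [Affine.Point.neg_some]
    refine ⟨hP.1, ?_⟩
    obtain ⟨p, _, k, hp, hk⟩ := FiniteField.card' F
    have hchar : CharP (AlgebraicClosure F) p := charP_of_injective_algebraMap' F p
    have : ExpChar (AlgebraicClosure F) p := .prime hp
    have hfix : ∀ a : F, (algebraMap F (AlgebraicClosure F) a) ^ (Fintype.card F ^ n) =
        algebraMap F (AlgebraicClosure F) a := fun a => by
      rw [← map_pow, FiniteField.pow_card_pow]
    have h1 : (E⁄(AlgebraicClosure F)).a₁ ^ (Fintype.card F ^ n) =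
      (E⁄(AlgebraicClosure F)).a₁ := hfix E.a₁
    have h3 : (E⁄(AlgebraicClosure F)).a₃ ^ (Fintype.card F ^ n) =
      (E⁄(AlgebraicClosure F)).a₃ := hfix E.a₃
    have hx := hP.1
    have hy := hP.2
    -- Since `q` is a power of the characteristic, raising to the power `q ^ n` is additive.
    have hsub : ∀ u v : AlgebraicClosure F, (u - v) ^ (Fintype.card F ^ n) =
        u ^ (Fintype.card F ^ n) - v ^ (Fintype.card F ^ n) := fun u v => by
      rw [hk, ← pow_mul]
      exact sub_pow_expChar_pow _ _ _
    have hneg : ∀ u : AlgebraicClosure F, (-u) ^ (Fintype.card F ^ n) =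
        -u ^ (Fintype.card F ^ n) := fun u => by
      have h0 := hsub 0 u
      rwa [zero_sub, zero_pow (pow_ne_zero _ Fintype.card_ne_zero), zero_sub] at h0
    rw [Affine.negY, hsub, hsub, hneg, mul_pow, hx, hy, h1, h3]

lemma isDefinedOver_neg_iff {n : ℕ} {P : E.GeomPoint} :
    E.IsDefinedOver n (-P) ↔ E.IsDefinedOver n P :=
  ⟨fun h => by simpa using isDefinedOver_neg h, isDefinedOver_neg⟩

/-- Frobenius acts on such a point as `1` or `-1`, so its square is the identity. -/
lemma isDefinedOver_two {x : F} {y : AlgebraicClosure F}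
    (h : (E⁄(AlgebraicClosure F)).Nonsingular (algebraMap F _ x) y) :
    E.IsDefinedOver 2 (.some _ y h) := by
  have hx : (algebraMap F (AlgebraicClosure F) x) ^ Fintype.card F ^ 2 = algebraMap F _ x := by
    rw [← map_pow, FiniteField.pow_card_pow]
  refine ⟨hx, ?_⟩
  have h2 : E.frobeniusPoint (E.frobeniusPoint (.some _ y h)) = .some _ y h := by
    rcases frobeniusPoint_eq_or_eq_neg h with h1 | h1
    · rw [h1, h1]
    · rw [h1, frobeniusPoint_neg, h1, neg_neg]
  obtain ⟨h', hP⟩ := frobeniusPoint_some h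
  obtain ⟨h'', hP'⟩ := frobeniusPoint_some h'
  rw [hP, hP'] at h2
  rw [pow_two, pow_mul]
  exact (Affine.Point.some.inj h2).2

lemma isDefinedOver_one_iff (h2 : (2 : F) ≠ 0) {x : F} {y : AlgebraicClosure F}
    (h : (E⁄(AlgebraicClosure F)).Nonsingular (algebraMap F _ x) y) :
    E.IsDefinedOver 1 (.some _ y h) ↔ IsSquare (E.Ψ₂Sq.eval x) := by
  have h2' : (2 : AlgebraicClosure F) ≠ 0 := by
    have := (map_ne_zero (algebraMap F (AlgebraicClosure F))).2 h2
    rwa [map_ofNat] at this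
  have hsq := eval_Ψ₂Sq_eq_sq h.1
  rw [eval_Ψ₂Sq_baseChange] at hsq
  have h1 : (E⁄(AlgebraicClosure F)).a₁ = algebraMap F _ E.a₁ := rfl
  have h3 : (E⁄(AlgebraicClosure F)).a₃ = algebraMap F _ E.a₃ := rfl
  rw [h1, h3] at hsq
  constructor
  · rintro ⟨-, hy⟩
    rw [pow_one] at hy
    obtain ⟨y₀, rfl⟩ := FiniteField.exists_algebraMap_eq_of_pow_card_eq hy
    refine ⟨2 * y₀ + E.a₁ * x + E.a₃, (algebraMap F (AlgebraicClosure F)).injective ?_⟩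
    rw [hsq]
    simp only [map_add, map_mul, map_ofNat]
    ring
  · rintro ⟨w, hw⟩
    refine ⟨by rw [pow_one, ← map_pow, FiniteField.pow_card], ?_⟩
    rw [hw, map_mul, ← pow_two] at hsq
    have hfix : ∀ z : F, y = algebraMap F _ z → y ^ Fintype.card F ^ 1 = y := by
      rintro z rfl
      rw [pow_one, ← map_pow, FiniteField.pow_card]
    rcases sq_eq_sq_iff_eq_or_eq_neg.1 hsq with h0 | h0
    · refine hfix ((w - E.a₁ * x - E.a₃) / 2) ?_
      simp only [map_sub, map_mul, map_div₀, map_ofNat]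
      field_simp
      linear_combination -h0
    · refine hfix ((-w - E.a₁ * x - E.a₃) / 2) ?_
      simp only [map_sub, map_neg, map_mul, map_div₀, map_ofNat]
      field_simp
      linear_combination h0

open Classical in
lemma isRationalSubgroupOfOrderThree_zmultiples {x : F} {y : AlgebraicClosure F}
    (h : (E⁄(AlgebraicClosure F)).Nonsingular (algebraMap F _ x) y) (hx : E.Ψ₃.eval x = 0) :
    E.IsRationalSubgroupOfOrderThree (AddSubgroup.zmultiples (.some _ y h)) := by
  have h3 : 3 • (Affine.Point.some _ y h) = 0 := by
    rw [Affine.Point.three_nsmul_eq_zero_iff, eval_Ψ₃_baseChange, hx, map_zero]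
  refine ⟨natCard_zmultiples_of_three_nsmul h3 (Affine.Point.some_ne_zero h), fun P hP => ?_⟩
  have hfrob : E.frobeniusPoint (.some _ y h) ∈ AddSubgroup.zmultiples (.some _ y h) := by
    rcases frobeniusPoint_eq_or_eq_neg h with h1 | h1 <;> rw [h1]
    · exact AddSubgroup.mem_zmultiples _
    · exact neg_mem (AddSubgroup.mem_zmultiples _)
  rcases mem_zmultiples_of_three_nsmul h3 hP with rfl | rfl | rfl
  · rw [frobeniusPoint_zero]
    exact zero_mem _
  · exact hfrob
  · rw [frobeniusPoint_neg]
    exact neg_mem hfrob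

-- Frobenius sends a generator `Q` to a nonzero element of `{0, Q, -Q}`, hence fixes its
-- `x`-coordinate.
open Classical in
lemma IsRationalSubgroupOfOrderThree.exists_eq_zmultiples {G : AddSubgroup E.GeomPoint}
    (hG : E.IsRationalSubgroupOfOrderThree G) :
    ∃ (x : F) (y : AlgebraicClosure F)
      (h : (E⁄(AlgebraicClosure F)).Nonsingular (algebraMap F _ x) y),
      E.Ψ₃.eval x = 0 ∧ G = AddSubgroup.zmultiples (.some _ y h) := by
  have hnt : G ≠ ⊥ := by
    rintro rfl
    simpa using hG.1
  obtain ⟨⟨Q, hP⟩, hQ⟩ := AddSubgroup.ne_bot_iff_exists_ne_zero.1 hnt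
  have h0 : Q ≠ 0 := fun h => hQ (Subtype.ext h)
  obtain ⟨h3, hGQ⟩ := eq_zmultiples_of_natCard_eq_three hG.1 hP h0
  cases Q with
  | zero => exact absurd rfl h0
  | some x y h =>
    have hF := hG.2 _ hP
    rw [hGQ] at hF
    obtain ⟨h', hfrob⟩ := frobeniusPoint_some h
    rw [hfrob] at hF
    have hx : x ^ Fintype.card F = x := by
      rcases mem_zmultiples_of_three_nsmul h3 hF with h1 | h1
      · exact absurd h1 (Affine.Point.some_ne_zero h')
      · exact Affine.Point.X_eq_iff.2 h1
    obtain ⟨x₀, rfl⟩ := FiniteField.exists_algebraMap_eq_of_pow_card_eq hx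
    refine ⟨x₀, y, h, ?_, hGQ⟩
    rw [Affine.Point.three_nsmul_eq_zero_iff, eval_Ψ₃_baseChange] at h3
    exact (map_eq_zero _).1 h3

open Classical in
theorem hasOnlyQuadraticThreeSubgroup_iff (h2 : (2 : F) ≠ 0) [E.IsElliptic] :
    E.HasOnlyQuadraticThreeSubgroup ↔ ∃ x₀, E.IsUniqueNonsquareRoot x₀ := by
  have h2' : (2 : AlgebraicClosure F) ≠ 0 := by
    have := (map_ne_zero (algebraMap F (AlgebraicClosure F))).2 h2
    rwa [map_ofNat] at this
  have hpoint : ∀ x : F, ∃ y, (E⁄(AlgebraicClosure F)).Nonsingular (algebraMap F _ x) y := fun x => by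
    have : (E⁄(AlgebraicClosure F)).IsElliptic :=
      inferInstanceAs (E.map (algebraMap F (AlgebraicClosure F))).IsElliptic
    obtain ⟨y, hy⟩ := exists_equation_of_isAlgClosed h2' (E⁄(AlgebraicClosure F)) (algebraMap F _ x)
    exact ⟨y, Affine.equation_iff_nonsingular.1 hy⟩
  constructor
  · rintro ⟨G, hG, huniq, hdef⟩
    obtain ⟨x, y, h, hx, hGP⟩ := hG.exists_eq_zmultiples
    have hP : .some _ y h ∈ G := hGP ▸ AddSubgroup.mem_zmultiples _
    refine ⟨x, hx, ?_, fun x' hx' => ?_⟩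
    · rw [← isDefinedOver_one_iff h2 h]
      exact (hdef _ hP (Affine.Point.some_ne_zero h)).2
    · obtain ⟨y', h'⟩ := hpoint x'
      have hmem := AddSubgroup.mem_zmultiples (Affine.Point.some _ y' h')
      rw [huniq _ (isRationalSubgroupOfOrderThree_zmultiples h' hx'), hGP] at hmem
      have h3 := (eq_zmultiples_of_natCard_eq_three hG.1 hP (Affine.Point.some_ne_zero h)).1
      rcases mem_zmultiples_of_three_nsmul h3 hmem with h1 | h1
      · exact absurd h1 (Affine.Point.some_ne_zero h')
      · exact (algebraMap F (AlgebraicClosure F)).injective (Affine.Point.X_eq_iff.2 h1)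
  · rintro ⟨x, hx, hsq, huniq⟩
    obtain ⟨y, h⟩ := hpoint x
    have hG := isRationalSubgroupOfOrderThree_zmultiples h hx
    refine ⟨_, hG, fun H hH => ?_, fun P hP h0 => ?_⟩
    · obtain ⟨x', y', h', hx', rfl⟩ := hH.exists_eq_zmultiples
      obtain rfl := huniq x' hx'
      rcases Affine.Point.X_eq_iff (h₁ := h') (h₂ := h) |>.1 rfl with h1 | h1 <;> rw [h1]
      exact AddSubgroup.zmultiples_neg
    · have h3 := (eq_zmultiples_of_natCard_eq_three hG.1 (AddSubgroup.mem_zmultiples _)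
        (Affine.Point.some_ne_zero h)).1
      rw [← isDefinedOver_one_iff h2 h] at hsq
      rcases mem_zmultiples_of_three_nsmul h3 hP with rfl | rfl | rfl
      · exact absurd rfl h0
      · exact ⟨isDefinedOver_two h, hsq⟩
      · exact ⟨isDefinedOver_neg (isDefinedOver_two h), fun h1 => hsq (isDefinedOver_neg_iff.1 h1)⟩

end RationalSubgroups

end WeierstrassCurve

namespace WeierstrassCurve

/-! ### Behaviour under changes of variables. -/

section Isomorphism

variable {F : Type*} [Field F]

lemma IsIsomorphicOver.symm {E E' : WeierstrassCurve F} (h : E.IsIsomorphicOver E') :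
    E'.IsIsomorphicOver E := by
  obtain ⟨C, rfl⟩ := h
  exact ⟨C⁻¹, inv_smul_smul _ _⟩

lemma IsIsomorphicOver.trans {E E' E'' : WeierstrassCurve F} (h : E.IsIsomorphicOver E')
    (h' : E'.IsIsomorphicOver E'') : E.IsIsomorphicOver E'' := by
  obtain ⟨C, rfl⟩ := h
  obtain ⟨D, rfl⟩ := h'
  exact ⟨D * C, mul_smul _ _ _⟩

lemma IsIsomorphicOver.isElliptic {E E' : WeierstrassCurve F} (h : E.IsIsomorphicOver E')
    (hE : E.IsElliptic) : E'.IsElliptic := by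
  obtain ⟨C, rfl⟩ := h
  infer_instance

lemma eval_Ψ₃_variableChange (C : VariableChange F) (E : WeierstrassCurve F) (x : F) :
    (C • E).Ψ₃.eval x = (C.u⁻¹ : Fˣ) ^ 8 * E.Ψ₃.eval (C.u ^ 2 * x + C.r) := by
  have hu : (C.u : F) ≠ 0 := C.u.ne_zero
  rw [eval_Ψ₃, eval_Ψ₃, variableChange_b₂, variableChange_b₄, variableChange_b₆,
    variableChange_b₈, Units.val_inv_eq_inv_val]
  field_simp
  ring

lemma eval_Ψ₂Sq_variableChange (C : VariableChange F) (E : WeierstrassCurve F) (x : F) :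
    (C • E).Ψ₂Sq.eval x = (C.u⁻¹ : Fˣ) ^ 6 * E.Ψ₂Sq.eval (C.u ^ 2 * x + C.r) := by
  have hu : (C.u : F) ≠ 0 := C.u.ne_zero
  rw [eval_Ψ₂Sq, eval_Ψ₂Sq, variableChange_b₂, variableChange_b₄, variableChange_b₆,
    Units.val_inv_eq_inv_val]
  field_simp
  ring

/-- `Ψ₂Sq` is rescaled by a sixth power, which does not affect being a square. -/
lemma IsUniqueNonsquareRoot.of_variableChange {C : VariableChange F} {E : WeierstrassCurve F}
    {x₀ : F} (h : (C • E).IsUniqueNonsquareRoot x₀) :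
    E.IsUniqueNonsquareRoot (C.u ^ 2 * x₀ + C.r) := by
  obtain ⟨h1, h2, h3⟩ := h
  have hu : (C.u : F) ≠ 0 := C.u.ne_zero
  rw [eval_Ψ₃_variableChange, mul_eq_zero_iff_left (pow_ne_zero _ C.u⁻¹.ne_zero)] at h1
  refine ⟨h1, fun ⟨w, hw⟩ => h2 ?_, fun x hx => ?_⟩
  · rw [eval_Ψ₂Sq_variableChange, hw]
    exact ⟨(C.u⁻¹ : Fˣ) ^ 3 * w, by ring⟩
  · have := h3 ((x - C.r) / C.u ^ 2) (by
      rw [eval_Ψ₃_variableChange, mul_div_cancel₀ _ (pow_ne_zero 2 hu), sub_add_cancel, hx,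
        mul_zero])
    rw [← this, mul_div_cancel₀ _ (pow_ne_zero 2 hu), sub_add_cancel]

lemma IsIsomorphicOver.exists_isUniqueNonsquareRoot {E E' : WeierstrassCurve F}
    (h : E.IsIsomorphicOver E') (h' : ∃ x, E'.IsUniqueNonsquareRoot x) :
    ∃ x, E.IsUniqueNonsquareRoot x := by
  obtain ⟨C, rfl⟩ := h
  obtain ⟨x, hx⟩ := h'
  exact ⟨_, hx.of_variableChange⟩

end Isomorphism

/-! ### The model with its 3-torsion root at `x = 0`. -/

section TwistedModel

variable {F : Type*} [Field F]

/-- The curve `y² = x³ + t (a x + t b)² / 4`, a model of the quadratic twist by `t` of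
`y² + a x y + b y = x³`. -/
def twistedModel (t a b : F) : WeierstrassCurve F :=
  { a₁ := 0, a₂ := t * a ^ 2 / 4, a₃ := 0, a₄ := t ^ 2 * a * b / 2, a₆ := t ^ 3 * b ^ 2 / 4 }

lemma twistedModel_isIsomorphicOver_twistedCurve (h2 : (2 : F) ≠ 0) (h3 : (3 : F) ≠ 0)
    (t a b : F) : (twistedModel t a b).IsIsomorphicOver (twistedCurve t a b) := by
  have h4 : (4 : F) = 2 ^ 2 := by norm_num
  have h12 : (12 : F) = 2 ^ 2 * 3 := by norm_num
  have h48 : (48 : F) = 2 ^ 4 * 3 := by norm_num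
  have h864 : (864 : F) = 2 ^ 5 * 3 ^ 3 := by norm_num
  have h24 : (24 : F) = 2 ^ 3 * 3 := by norm_num
  -- Translation by `-a₂/3` removes the `x²` term.
  refine ⟨⟨1, -(t * a ^ 2) / 12, 0, 0⟩, ?_⟩
  ext <;> simp only [variableChange_def, twistedModel, twistedCurve, shortCurve, coeffA, coeffB,
    inv_one, Units.val_one, h4, h12, h48, h864] <;> (try rw [h24]) <;> field_simp <;> ring

lemma threePointCurve_isIsomorphicOver_shortCurve (h2 : (2 : F) ≠ 0) (h3 : (3 : F) ≠ 0)
    (a b : F) :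
    (threePointCurve a b).IsIsomorphicOver (shortCurve (coeffA a b) (coeffB a b)) := by
  have h4 : (4 : F) = 2 ^ 2 := by norm_num
  have h12 : (12 : F) = 2 ^ 2 * 3 := by norm_num
  have h48 : (48 : F) = 2 ^ 4 * 3 := by norm_num
  have h864 : (864 : F) = 2 ^ 5 * 3 ^ 3 := by norm_num
  have h24 : (24 : F) = 2 ^ 3 * 3 := by norm_num
  -- The three shifts remove the terms in `x²`, `xy` and `y`.
  refine ⟨⟨1, -a ^ 2 / 12, -a / 2, -(b - a ^ 3 / 12) / 2⟩, ?_⟩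
  ext <;> simp only [variableChange_def, threePointCurve, shortCurve, coeffA, coeffB,
    inv_one, Units.val_one, h4, h12, h48, h864] <;> (try rw [h24]) <;> field_simp <;> ring

lemma Δ_threePointCurve (a b : F) : (threePointCurve a b).Δ = b ^ 3 * (a ^ 3 - 27 * b) := by
  simp only [Δ, b₂, b₄, b₆, b₈, threePointCurve]
  ring

lemma Δ_twistedModel (h2 : (2 : F) ≠ 0) (t a b : F) :
    (twistedModel t a b).Δ = t ^ 6 * (b ^ 3 * (a ^ 3 - 27 * b)) := by
  have h4 : (4 : F) = 2 ^ 2 := by norm_num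
  simp only [Δ, b₂, b₄, b₆, b₈, twistedModel, h4]
  field_simp
  ring

lemma isElliptic_threePointCurve {a b : F} (hb : b ≠ 0) (hab : ¬ ∃ x : F, x ^ 3 = a ^ 3 - 27 * b) :
    (threePointCurve a b).IsElliptic := by
  refine ⟨?_⟩
  rw [Δ_threePointCurve, isUnit_iff_ne_zero]
  -- Zero is a cube, so a non-cube `a³ - 27b` is nonzero.
  exact mul_ne_zero (pow_ne_zero _ hb) fun h => hab ⟨0, by rw [h]; ring⟩

lemma isElliptic_twistedModel (h2 : (2 : F) ≠ 0) {t a b : F} (ht : t ≠ 0) (hb : b ≠ 0)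
    (hab : ¬ ∃ x : F, x ^ 3 = a ^ 3 - 27 * b) : (twistedModel t a b).IsElliptic := by
  refine ⟨?_⟩
  rw [Δ_twistedModel h2, isUnit_iff_ne_zero]
  exact mul_ne_zero (pow_ne_zero _ ht)
    (mul_ne_zero (pow_ne_zero _ hb) fun h => hab ⟨0, by rw [h]; ring⟩)

lemma eval_Ψ₃_threePointCurve (a b x : F) : (threePointCurve a b).Ψ₃.eval x =
    x * (3 * x ^ 3 + a ^ 2 * x ^ 2 + 3 * a * b * x + 3 * b ^ 2) := by
  simp only [eval_Ψ₃, b₂, b₄, b₆, b₈, threePointCurve]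
  ring

lemma eval_Ψ₃_twistedModel (h2 : (2 : F) ≠ 0) (t a b x : F) : (twistedModel t a b).Ψ₃.eval x =
    x * (3 * x ^ 3 + t * a ^ 2 * x ^ 2 + 3 * t ^ 2 * a * b * x + 3 * t ^ 3 * b ^ 2) := by
  have h4 : (4 : F) = 2 ^ 2 := by norm_num
  simp only [eval_Ψ₃, b₂, b₄, b₆, b₈, twistedModel, h4]
  field_simp
  ring

lemma eval_Ψ₂Sq_twistedModel (h2 : (2 : F) ≠ 0) (t a b : F) :
    (twistedModel t a b).Ψ₂Sq.eval 0 = t * (t * b) ^ 2 := by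
  have h4 : (4 : F) = 2 ^ 2 := by norm_num
  simp only [eval_Ψ₂Sq, b₂, b₄, b₆, twistedModel, h4]
  field_simp
  ring

/-- The Möbius substitution `c = a + 3bt/x` gives `x³(c³ - a³) = 9b(ta²x² + 3t²abx + 3t³b²)`, which
equals `-27bx³` at a root. -/
lemma exists_root_iff_exists_cube (h3 : (3 : F) ≠ 0) {t a b : F} (ht : t ≠ 0) (hb : b ≠ 0) :
    (∃ x, 3 * x ^ 3 + t * a ^ 2 * x ^ 2 + 3 * t ^ 2 * a * b * x + 3 * t ^ 3 * b ^ 2 = 0) ↔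
      ∃ c : F, c ^ 3 = a ^ 3 - 27 * b := by
  constructor
  · rintro ⟨x, hx⟩
    have hx0 : x ≠ 0 := by
      rintro rfl
      have : 3 * t ^ 3 * b ^ 2 = 0 := by linear_combination hx
      simp [h3, ht, hb] at this
    refine ⟨a + 3 * b * t / x, ?_⟩
    field_simp
    linear_combination 9 * b * hx
  · rintro ⟨c, hc⟩
    have hca : c - a ≠ 0 := by
      intro h
      have : 3 ^ 3 * b = 0 := by
        rw [sub_eq_zero.1 h] at hc
        linear_combination hc
      simp [h3, hb] at this
    refine ⟨3 * b * t / (c - a), ?_⟩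
    field_simp
    linear_combination 3 * b ^ 2 * t ^ 3 * hc

/-- The value of `Ψ₂Sq` at `0` is `t(tb)²`, always a nonsquare, so only uniqueness of the root is at
stake. -/
lemma isUniqueNonsquareRoot_twistedModel_iff (h2 : (2 : F) ≠ 0) (h3 : (3 : F) ≠ 0) {t a b : F}
    (ht : ¬ IsSquare t) (hb : b ≠ 0) :
    (twistedModel t a b).IsUniqueNonsquareRoot 0 ↔ ¬ ∃ x : F, x ^ 3 = a ^ 3 - 27 * b := by
  have ht0 : t ≠ 0 := fun h => ht (h ▸ IsSquare.zero)
  rw [← exists_root_iff_exists_cube h3 ht0 hb]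
  constructor
  · rintro ⟨-, -, h⟩ ⟨x, hx⟩
    obtain rfl := h x (by rw [eval_Ψ₃_twistedModel h2, hx, mul_zero])
    have : 3 * t ^ 3 * b ^ 2 = 0 := by linear_combination hx
    simp [h3, ht0, hb] at this
  · intro h
    refine ⟨by rw [eval_Ψ₃_twistedModel h2, zero_mul], ?_, fun x hx => ?_⟩
    · rw [eval_Ψ₂Sq_twistedModel h2]
      rintro ⟨w, hw⟩
      refine ht ⟨w / (t * b), ?_⟩
      field_simp
      linear_combination hw
    · rw [eval_Ψ₃_twistedModel h2] at hx
      exact (mul_eq_zero.1 hx).resolve_right fun h0 => h ⟨x, h0⟩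

lemma twistedModel_isIsomorphicOver_of_scaling {t a b w : F} (hw : w ≠ 0) :
    (twistedModel t a b).IsIsomorphicOver (twistedModel t (w * a) (w ^ 3 * b)) := by
  refine ⟨⟨(Units.mk0 w hw)⁻¹, 0, 0, 0⟩, ?_⟩
  ext <;> simp only [variableChange_def, twistedModel, inv_inv, Units.val_mk0] <;> ring

lemma twistedModel_isIsomorphicOver_iff (h2 : (2 : F) ≠ 0) {t a b a' b' : F} (ht : t ≠ 0)
    (hb : b ≠ 0) (h : (twistedModel t a b).IsUniqueNonsquareRoot 0)
    (h' : (twistedModel t a' b').IsUniqueNonsquareRoot 0) :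
    (twistedModel t a b).IsIsomorphicOver (twistedModel t a' b') ↔
      ∃ w, w ≠ 0 ∧ a' = w * a ∧ b' = w ^ 3 * b := by
  have h4 : (4 : F) ≠ 0 := by
    rw [show (4 : F) = 2 ^ 2 by norm_num]
    exact pow_ne_zero _ h2
  constructor
  · rintro ⟨⟨u, r, s, v⟩, hC⟩
    rw [← hC] at h'
    -- The change of variables carries the unique root of `Ψ₃` to the unique root, and both are `0`.
    have hr : r = 0 := by
      have := h.2.2 _ h'.of_variableChange.1
      simpa using this
    subst hr
    have hu := (u⁻¹).ne_zero
    simp only [variableChange_def, twistedModel, WeierstrassCurve.mk.injEq] at hC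
    obtain ⟨e1, e2, e3, e4, e6⟩ := hC
    obtain rfl : s = 0 := by simpa [h2] using e1
    obtain rfl : v = 0 := by simpa [h2] using e3
    generalize ((u⁻¹ : Fˣ) : F) = w at hu e2 e4 e6
    have e6' : b' ^ 2 = (w ^ 3 * b) ^ 2 := by
      refine mul_left_cancel₀ (pow_ne_zero 3 ht) ?_
      refine (div_left_inj' h4).1 ?_
      linear_combination -e6
    have e4' : a' * b' = w ^ 4 * a * b := by
      refine mul_left_cancel₀ (pow_ne_zero 2 ht) ?_
      refine (div_left_inj' h2).1 ?_
      linear_combination -e4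
    -- The coefficients give only `b'² = (w³b)²` and `a'b' = w⁴ab`. The sign ambiguity is absorbed
    -- by replacing `w` with `-w`, which leaves `w⁴` unchanged.
    have key : ∀ z, z ≠ 0 → z ^ 4 = w ^ 4 → b' = z ^ 3 * b →
        ∃ w, w ≠ 0 ∧ a' = w * a ∧ b' = w ^ 3 * b := fun z hz hzw hzb => by
      refine ⟨z, hz, ?_, hzb⟩
      refine mul_right_cancel₀ (mul_ne_zero (pow_ne_zero 3 hz) hb) ?_
      rw [hzb, ← hzw] at e4'
      linear_combination e4'
    rcases sq_eq_sq_iff_eq_or_eq_neg.1 e6' with h0 | h0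
    · exact key w hu rfl h0
    · exact key (-w) (neg_ne_zero.2 hu) (by ring) (by rw [h0]; ring)
  · rintro ⟨w, hw, rfl, rfl⟩
    exact twistedModel_isIsomorphicOver_of_scaling hw

end TwistedModel

end WeierstrassCurve

/-! ### Cubes and squares in `F`. -/

section Cubes

variable {F : Type*} [Field F]

/-- In characteristic three `X³ - 1 = (X - 1)³`, so `1` is the only cube root of unity. -/
lemma IsPrimitiveRoot.three_ne_zero {ρ : F} (hρ : IsPrimitiveRoot ρ 3) : (3 : F) ≠ 0 := by
  intro h
  have h1 : (ρ - 1) ^ 3 = 0 := by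
    linear_combination hρ.pow_eq_one + (ρ - ρ ^ 2) * h
  exact hρ.ne_one (by norm_num) (sub_eq_zero.1 (pow_eq_zero_iff (by norm_num) |>.1 h1))

lemma IsPrimitiveRoot.cube_eq_one_iff {ρ : F} (hρ : IsPrimitiveRoot ρ 3) {w : F} :
    w ^ 3 = 1 ↔ w = 1 ∨ w = ρ ∨ w = ρ ^ 2 := by
  constructor
  · intro h
    obtain ⟨i, hi, rfl⟩ := hρ.eq_pow_of_pow_eq_one h
    interval_cases i <;> simp
  · have := hρ.pow_eq_one
    rintro (rfl | rfl | rfl)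
    · exact one_pow 3
    · exact this
    · rw [← pow_mul, mul_comm, pow_mul, this, one_pow]

lemma IsPrimitiveRoot.cube_eq_cube_iff {ρ : F} (hρ : IsPrimitiveRoot ρ 3) {a a' : F} :
    a' ^ 3 = a ^ 3 ↔ a' = a ∨ a' = ρ * a ∨ a' = ρ ^ 2 * a := by
  rcases eq_or_ne a 0 with rfl | ha
  · simp
  · rw [← div_eq_one_iff_eq (pow_ne_zero 3 ha), ← div_pow, hρ.cube_eq_one_iff, div_eq_iff ha,
      div_eq_iff ha, div_eq_iff ha, one_mul]

/-- If `i ≠ j` then `b₀` to an exponent prime to `3` is a cube, which makes `b₀` itself a cube. -/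
lemma eq_of_pow_eq_cube_mul_pow {b₀ : F} (hb₀ : ¬ ∃ x : F, x ^ 3 = b₀) {i j : Fin 3} {w : F}
    (h : b₀ ^ (j : ℕ) = w ^ 3 * b₀ ^ (i : ℕ)) : i = j := by
  have h0 : b₀ ≠ 0 := by
    rintro rfl
    exact hb₀ ⟨0, by norm_num⟩
  have hw : w ≠ 0 := by
    rintro rfl
    rw [zero_pow (by norm_num), zero_mul] at h
    exact pow_ne_zero _ h0 h
  fin_cases i <;> fin_cases j <;> simp at h <;> first | rfl | exfalso; apply hb₀
  · exact ⟨w, by rw [h]⟩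
  · exact ⟨b₀ / w, by field_simp; linear_combination h⟩
  · exact ⟨1 / w, by field_simp; linear_combination h⟩
  · exact ⟨w, by refine mul_right_cancel₀ h0 ?_; linear_combination -h⟩
  · exact ⟨b₀ * w, by rw [mul_pow]; linear_combination -b₀ * h⟩
  · refine ⟨1 / w, mul_right_cancel₀ h0 ?_⟩
    field_simp
    refine mul_left_cancel₀ h0 ?_
    linear_combination h

lemma exists_eq_cube_mul_pow [Finite F] {b₀ : F} (hb₀ : ¬ ∃ x : F, x ^ 3 = b₀) {b : F}
    (hb : b ≠ 0) : ∃ (i : Fin 3) (s : F), s ≠ 0 ∧ b = s ^ 3 * b₀ ^ (i : ℕ) := by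
  have h0 : b₀ ≠ 0 := by
    rintro rfl
    exact hb₀ ⟨0, by norm_num⟩
  obtain ⟨g, hg⟩ := IsCyclic.exists_generator (α := Fˣ)
  obtain ⟨m, hm⟩ := Subgroup.mem_zpowers_iff.1 (hg (Units.mk0 b₀ h0))
  obtain ⟨k, hk⟩ := Subgroup.mem_zpowers_iff.1 (hg (Units.mk0 b hb))
  have hm' : b₀ = (g : F) ^ m := by
    simpa using (congrArg Units.val hm).symm
  have hk' : b = (g : F) ^ k := by
    simpa using (congrArg Units.val hk).symm
  have hg0 := g.ne_zero
  have hm3 : ¬ (3 : ℤ) ∣ m := by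
    rintro ⟨l, rfl⟩
    exact hb₀ ⟨(g : F) ^ l, by rw [hm', mul_comm, zpow_mul]; norm_cast⟩
  -- As `3 ∤ m`, the multiples `0, m, 2m` cover all residues modulo `3`.
  obtain ⟨i, l, hil⟩ : ∃ (i : Fin 3) (l : ℤ), k = l * 3 + m * (i : ℕ) := by
    have h1 : m % 3 = 1 ∨ m % 3 = 2 := by omega
    have h2 : k % 3 = 0 ∨ k % 3 = 1 ∨ k % 3 = 2 := by omega
    rcases h2 with h2 | h2 | h2
    · exact ⟨0, k / 3, by simp; omega⟩
    · rcases h1 with h1 | h1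
      · exact ⟨1, (k - m) / 3, by simp; omega⟩
      · exact ⟨2, (k - m * 2) / 3, by simp; omega⟩
    · rcases h1 with h1 | h1
      · exact ⟨2, (k - m * 2) / 3, by simp; omega⟩
      · exact ⟨1, (k - m) / 3, by simp; omega⟩
  refine ⟨i, (g : F) ^ l, zpow_ne_zero _ hg0, ?_⟩
  rw [hk', hm', hil, zpow_add₀ hg0, zpow_mul, zpow_mul]
  norm_cast

lemma exists_eq_mul_sq_of_not_isSquare [Finite F] {t v : F} (ht : ¬ IsSquare t)
    (hv : ¬ IsSquare v) : ∃ w, v = t * w ^ 2 := by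
  classical
  have := Fintype.ofFinite F
  have ht0 : t ≠ 0 := fun h => ht (h ▸ IsSquare.zero)
  have hv0 : v ≠ 0 := fun h => hv (h ▸ IsSquare.zero)
  have h1 : quadraticChar F (v * t) = 1 := by
    rw [map_mul, quadraticChar_neg_one_iff_not_isSquare.2 ht,
      quadraticChar_neg_one_iff_not_isSquare.2 hv]
    norm_num
  obtain ⟨w, hw⟩ := (quadraticChar_one_iff_isSquare (mul_ne_zero hv0 ht0)).1 h1
  refine ⟨w / t, ?_⟩
  field_simp
  linear_combination hw

/-- Cubing on `Fˣ` has kernel of order three, hence `(q - 1)/3` nonzero cubes. Zero is one more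
cube, encoded below as `none`. -/
lemma three_mul_natCard_not_cube [Fintype F] {ρ : F} (hρ : IsPrimitiveRoot ρ 3) :
    3 * Nat.card {y : F // ¬ ∃ x : F, x ^ 3 = y} + 2 = 2 * Fintype.card F := by
  classical
  have hker : Nat.card (powMonoidHom 3 : Fˣ →* Fˣ).ker = 3 := by
    have h1 : (powMonoidHom 3 : Fˣ →* Fˣ).ker = rootsOfUnity 3 F := by
      ext u
      simp [MonoidHom.mem_ker, mem_rootsOfUnity]
    rw [h1, hρ.card_rootsOfUnity]
  have hmul := Subgroup.card_mul_index (powMonoidHom 3 : Fˣ →* Fˣ).ker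
  rw [Subgroup.index_ker, hker, Nat.card_eq_fintype_card (α := Fˣ), Fintype.card_units] at hmul
  have hcubes : Nat.card {y : F // ∃ x : F, x ^ 3 = y} =
      Nat.card (powMonoidHom 3 : Fˣ →* Fˣ).range + 1 := by
    rw [← Finite.card_option]
    symm
    refine Nat.card_congr (Equiv.ofBijective (fun o : Option (powMonoidHom 3 : Fˣ →* Fˣ).range =>
      (o.elim ⟨0, 0, by norm_num⟩ fun u => ⟨(u : Fˣ), by
        obtain ⟨v, hv⟩ := u.2
        exact ⟨v, by rw [← hv]; simp⟩⟩ : {y : F // ∃ x : F, x ^ 3 = y})) ⟨?_, ?_⟩)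
    · rintro (_ | u) (_ | v) h
      · rfl
      · exact absurd (congrArg Subtype.val h).symm (v : Fˣ).ne_zero
      · exact absurd (congrArg Subtype.val h) (u : Fˣ).ne_zero
      · exact congrArg some (Subtype.ext (Units.ext (congrArg Subtype.val h)))
    · rintro ⟨y, x, rfl⟩
      rcases eq_or_ne x 0 with rfl | hx
      · exact ⟨none, Subtype.ext (by simp)⟩
      · exact ⟨some ⟨Units.mk0 x hx ^ 3, Units.mk0 x hx, rfl⟩, Subtype.ext (by simp)⟩
  have hcompl : Nat.card {y : F // ∃ x : F, x ^ 3 = y} +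
      Nat.card {y : F // ¬ ∃ x : F, x ^ 3 = y} = Fintype.card F := by
    rw [Nat.card_eq_fintype_card, Nat.card_eq_fintype_card,
      ← Fintype.card_congr (Equiv.sumCompl fun y : F => ∃ x : F, x ^ 3 = y), Fintype.card_sum]
  have := Fintype.card_pos (α := F)
  omega

end Cubes

/-! ### Rational 3-torsion of the untwisted curve, and reduction to the twisted model. -/

namespace WeierstrassCurve

variable {F : Type*} [Field F]

open Classical in
lemma natCard_rationalThreeTorsion_threePointCurve (h3 : (3 : F) ≠ 0) {a b : F} (hb : b ≠ 0)
    (hab : ¬ ∃ x : F, x ^ 3 = a ^ 3 - 27 * b) :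
    Nat.card (threePointCurve a b).rationalThreeTorsion = 3 := by
  have hns : (threePointCurve a b).toAffine.Nonsingular 0 0 := by
    rw [Affine.nonsingular_zero]
    exact ⟨rfl, Or.inl hb⟩
  have hP : 3 • Affine.Point.some 0 0 hns = 0 := by
    rw [Affine.Point.three_nsmul_eq_zero_iff, eval_Ψ₃_threePointCurve, zero_mul]
  have heq : (threePointCurve a b).rationalThreeTorsion =
      AddSubgroup.zmultiples (Affine.Point.some 0 0 hns) := by
    refine le_antisymm (fun Q hQ => ?_) ((AddSubgroup.zmultiples_le_of_mem) ?_)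
    · have hQ3 : 3 • Q = 0 := by
        have : (3 : ℤ) • Q = 0 := by
          simpa [rationalThreeTorsion] using hQ
        exact_mod_cast this
      cases Q with
      | zero => exact zero_mem _
      | some x y h =>
        rw [Affine.Point.three_nsmul_eq_zero_iff, eval_Ψ₃_threePointCurve] at hQ3
        -- The case `t = 1` of the root criterion excludes every root of `Ψ₃` other than `0`.
        have hx : x = 0 := (mul_eq_zero.1 hQ3).resolve_right fun h0 =>
          hab ((exists_root_iff_exists_cube h3 one_ne_zero hb).1
            ⟨x, by linear_combination h0⟩)
        rcases Affine.Point.X_eq_iff (h₁ := h) (h₂ := hns) |>.1 hx with h1 | h1 <;> rw [h1]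
        · exact AddSubgroup.mem_zmultiples _
        · exact neg_mem (AddSubgroup.mem_zmultiples _)
    · have : (3 : ℤ) • Affine.Point.some 0 0 hns = 0 := by exact_mod_cast hP
      simpa [rationalThreeTorsion] using this
  rw [heq]
  exact natCard_zmultiples_of_three_nsmul hP (Affine.Point.some_ne_zero hns)

lemma IsUniqueNonsquareRoot.exists_isIsomorphicOver_twistedModel [Finite F] (h2 : (2 : F) ≠ 0)
    {t : F} (ht : ¬ IsSquare t) {E : WeierstrassCurve F} {x₀ : F}
    (h : E.IsUniqueNonsquareRoot x₀) :
    ∃ a b : F, b ≠ 0 ∧ E.IsIsomorphicOver (twistedModel t a b) := by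
  have ht0 : t ≠ 0 := fun h => ht (h ▸ IsSquare.zero)
  have h4 : (4 : F) = 2 ^ 2 := by norm_num
  -- Move `x₀` to `0` and complete the square in `y`.
  set C : VariableChange F := ⟨1, x₀, -E.a₁ / 2, -(E.a₃ + x₀ * E.a₁) / 2⟩ with hC
  have ha₁ : (C • E).a₁ = 0 := by
    rw [variableChange_a₁, hC]
    field_simp
    ring
  have ha₃ : (C • E).a₃ = 0 := by
    rw [variableChange_a₃, hC]
    field_simp
    ring
  have hroot : (C • E).Ψ₃.eval 0 = 0 := by
    rw [eval_Ψ₃_variableChange, hC]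
    simpa using h.1
  have hns : ¬ IsSquare ((C • E).Ψ₂Sq.eval 0) := by
    rw [eval_Ψ₂Sq_variableChange, hC]
    simpa using h.2.1
  have hiso : E.IsIsomorphicOver (C • E) := ⟨C, rfl⟩
  generalize C • E = E' at *
  obtain ⟨w, hw⟩ := exists_eq_mul_sq_of_not_isSquare ht hns
  have hw0 : w ≠ 0 := by
    rintro rfl
    rw [hw] at hns
    exact hns ⟨0, by ring⟩
  rw [eval_Ψ₂Sq, b₆, ha₃] at hw
  rw [eval_Ψ₃, b₈, ha₁, ha₃] at hroot
  -- Now `4a₆ = tw²`, and `Ψ₃(0) = b₈ = 0` reads `4a₂a₆ = a₄²`. Hence `a₂x² + a₄x + a₆` is `t` times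
  -- the square of a linear form, from which `a` and `b` are read off.
  have hE' : E' = twistedModel t (2 * E'.a₄ / (t * w)) (w / t) := by
    ext
    · exact ha₁
    · refine mul_left_cancel₀ (mul_ne_zero ht0 (pow_ne_zero 2 hw0)) ?_
      simp only [twistedModel, h4]
      field_simp
      linear_combination hroot - E'.a₂ * hw
    · exact ha₃
    · simp only [twistedModel]
      field_simp
    · simp only [twistedModel, h4]
      field_simp
      linear_combination hw
  exact ⟨_, _, div_ne_zero hw0 ht0, hE' ▸ hiso⟩

end WeierstrassCurve

namespace WeierstrassCurve

variable {F : Type*} [Field F]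

/-! ### Membership, isomorphisms and completeness for the family. -/

section Family

lemma two_ne_zero_of_not_isSquare [Finite F] {t : F} (ht : ¬ IsSquare t) : (2 : F) ≠ 0 := by
  intro h
  exact ht (FiniteField.isSquare_of_char_two
    (ringChar.eq_iff.2 (CharTwo.of_one_ne_zero_of_two_eq_zero one_ne_zero h)) t)

lemma isElliptic_twistedCurve (h2 : (2 : F) ≠ 0) (h3 : (3 : F) ≠ 0) {t a b : F} (ht : t ≠ 0)
    (hb : b ≠ 0) (hab : ¬ ∃ x : F, x ^ 3 = a ^ 3 - 27 * b) : (twistedCurve t a b).IsElliptic :=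
  (twistedModel_isIsomorphicOver_twistedCurve h2 h3 t a b).isElliptic
    (isElliptic_twistedModel h2 ht hb hab)

lemma hasOnlyQuadraticThreeSubgroup_twistedCurve [Fintype F] (h3 : (3 : F) ≠ 0) {t a b : F}
    (ht : ¬ IsSquare t) (hb : b ≠ 0) (hab : ¬ ∃ x : F, x ^ 3 = a ^ 3 - 27 * b) :
    (twistedCurve t a b).HasOnlyQuadraticThreeSubgroup := by
  have h2 := two_ne_zero_of_not_isSquare ht
  have ht0 : t ≠ 0 := fun h => ht (h ▸ IsSquare.zero)
  have := isElliptic_twistedCurve h2 h3 ht0 hb hab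
  rw [hasOnlyQuadraticThreeSubgroup_iff h2]
  exact (twistedModel_isIsomorphicOver_twistedCurve h2 h3 t a b).symm.exists_isUniqueNonsquareRoot
    ⟨0, (isUniqueNonsquareRoot_twistedModel_iff h2 h3 ht hb).2 hab⟩

lemma twistedCurve_isIsomorphicOver_iff [Finite F] (h3 : (3 : F) ≠ 0) {t a b a' b' : F}
    (ht : ¬ IsSquare t) (hb : b ≠ 0) (hb' : b' ≠ 0)
    (hab : ¬ ∃ x : F, x ^ 3 = a ^ 3 - 27 * b) (hab' : ¬ ∃ x : F, x ^ 3 = a' ^ 3 - 27 * b') :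
    (twistedCurve t a b).IsIsomorphicOver (twistedCurve t a' b') ↔
      ∃ w, w ≠ 0 ∧ a' = w * a ∧ b' = w ^ 3 * b := by
  have h2 := two_ne_zero_of_not_isSquare ht
  have ht0 : t ≠ 0 := fun h => ht (h ▸ IsSquare.zero)
  have hiso := twistedModel_isIsomorphicOver_twistedCurve h2 h3 t a b
  have hiso' := twistedModel_isIsomorphicOver_twistedCurve h2 h3 t a' b'
  rw [← twistedModel_isIsomorphicOver_iff h2 ht0 hb
    ((isUniqueNonsquareRoot_twistedModel_iff h2 h3 ht hb).2 hab)
    ((isUniqueNonsquareRoot_twistedModel_iff h2 h3 ht hb').2 hab')]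
  exact ⟨fun h => (hiso.trans h).trans hiso'.symm, fun h => (hiso.symm.trans h).trans hiso'⟩

lemma twistedCurve_pow_isIsomorphicOver_iff [Finite F] {ρ : F} (hρ : IsPrimitiveRoot ρ 3)
    {t b₀ : F} (ht : ¬ IsSquare t) (hb₀ : ¬ ∃ x : F, x ^ 3 = b₀) {i j : Fin 3} {a a' : F}
    (hab : ¬ ∃ x : F, x ^ 3 = a ^ 3 - 27 * b₀ ^ (i : ℕ))
    (hab' : ¬ ∃ x : F, x ^ 3 = a' ^ 3 - 27 * b₀ ^ (j : ℕ)) :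
    (twistedCurve t a (b₀ ^ (i : ℕ))).IsIsomorphicOver (twistedCurve t a' (b₀ ^ (j : ℕ))) ↔
      i = j ∧ (a' = a ∨ a' = ρ * a ∨ a' = ρ ^ 2 * a) := by
  have h0 : b₀ ≠ 0 := by
    rintro rfl
    exact hb₀ ⟨0, by norm_num⟩
  have hρ0 : ρ ≠ 0 := hρ.ne_zero (by norm_num)
  rw [twistedCurve_isIsomorphicOver_iff hρ.three_ne_zero ht (pow_ne_zero _ h0) (pow_ne_zero _ h0)
    hab hab']
  constructor
  · rintro ⟨w, -, rfl, hb⟩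
    obtain rfl := eq_of_pow_eq_cube_mul_pow hb₀ hb
    refine ⟨rfl, hρ.cube_eq_cube_iff.1 ?_⟩
    have hw : w ^ 3 = 1 := mul_right_cancel₀ (pow_ne_zero _ h0) (by rw [one_mul, ← hb])
    rw [mul_pow, hw, one_mul]
  · have key : ∀ w : F, w ^ 3 = 1 → b₀ ^ (i : ℕ) = w ^ 3 * b₀ ^ (i : ℕ) := fun w hw => by
      rw [hw, one_mul]
    rintro ⟨rfl, rfl | rfl | rfl⟩
    · exact ⟨1, one_ne_zero, (one_mul _).symm, key _ (one_pow 3)⟩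
    · exact ⟨ρ, hρ0, rfl, key _ hρ.pow_eq_one⟩
    · exact ⟨ρ ^ 2, pow_ne_zero 2 hρ0, rfl, key _ (hρ.cube_eq_one_iff.2 (Or.inr (Or.inr rfl)))⟩

lemma exists_isIsomorphicOver_twistedCurve_pow [Fintype F] (h3 : (3 : F) ≠ 0) {t b₀ : F}
    (ht : ¬ IsSquare t) (hb₀ : ¬ ∃ x : F, x ^ 3 = b₀) {E : WeierstrassCurve F}
    (hE : E.IsElliptic) (h : E.HasOnlyQuadraticThreeSubgroup) :
    ∃ (i : Fin 3) (a : F), (¬ ∃ x : F, x ^ 3 = a ^ 3 - 27 * b₀ ^ (i : ℕ)) ∧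
      E.IsIsomorphicOver (twistedCurve t a (b₀ ^ (i : ℕ))) := by
  have h0 : b₀ ≠ 0 := by
    rintro rfl
    exact hb₀ ⟨0, by norm_num⟩
  have h2 := two_ne_zero_of_not_isSquare ht
  obtain ⟨x₀, hx₀⟩ := (hasOnlyQuadraticThreeSubgroup_iff h2).1 h
  obtain ⟨a, b, hb, hiso⟩ := hx₀.exists_isIsomorphicOver_twistedModel h2 ht
  obtain ⟨i, s, hs, rfl⟩ := exists_eq_cube_mul_pow hb₀ hb
  -- Scaling by `s⁻¹` strips the cube from `b = s³b₀^i`.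
  have hiso' := hiso.trans (twistedModel_isIsomorphicOver_of_scaling (inv_ne_zero hs))
  rw [← mul_assoc, ← mul_pow, inv_mul_cancel₀ hs, one_pow, one_mul] at hiso'
  refine ⟨i, s⁻¹ * a, ?_,
    hiso'.trans (twistedModel_isIsomorphicOver_twistedCurve h2 h3 _ _ _)⟩
  rw [← isUniqueNonsquareRoot_twistedModel_iff h2 h3 ht (pow_ne_zero _ h0)]
  obtain ⟨x, hx⟩ := hiso'.symm.exists_isUniqueNonsquareRoot ⟨x₀, hx₀⟩
  -- Since `0` is a root, the transported unique root is `0`.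
  rwa [hx.2.2 0 (by rw [eval_Ψ₃_twistedModel h2, zero_mul])]

lemma existsUnique_isIsomorphicOver_twistedCurve_pow [Fintype F] {ρ : F}
    (hρ : IsPrimitiveRoot ρ 3) {t b₀ : F} (ht : ¬ IsSquare t) (hb₀ : ¬ ∃ x : F, x ^ 3 = b₀)
    {m : F → F} (hm : ∀ a, m a = a ∨ m a = ρ * a ∨ m a = ρ ^ 2 * a) (hmρ : ∀ a, m (ρ * a) = m a)
    {E : WeierstrassCurve F} (hE : E.IsElliptic) (h : E.HasOnlyQuadraticThreeSubgroup) :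
    ∃! p : Fin 3 × F, m p.2 = p.2 ∧ (¬ ∃ x : F, x ^ 3 = p.2 ^ 3 - 27 * b₀ ^ (p.1 : ℕ)) ∧
      E.IsIsomorphicOver (twistedCurve t p.2 (b₀ ^ (p.1 : ℕ))) := by
  have hconst : ∀ a a', a' = a ∨ a' = ρ * a ∨ a' = ρ ^ 2 * a → m a' = m a := by
    rintro a _ (rfl | rfl | rfl)
    · rfl
    · exact hmρ a
    · rw [pow_two, mul_assoc, hmρ, hmρ]
  obtain ⟨i, a, hab, hiso⟩ :=
    exists_isIsomorphicOver_twistedCurve_pow hρ.three_ne_zero ht hb₀ hE h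
  have hma : ¬ ∃ x : F, x ^ 3 = m a ^ 3 - 27 * b₀ ^ (i : ℕ) := by
    rwa [hρ.cube_eq_cube_iff.2 (hm a)]
  refine ⟨(i, m a), ⟨hconst _ _ (hm a), hma, hiso.trans ?_⟩, ?_⟩
  · exact (twistedCurve_pow_isIsomorphicOver_iff hρ ht hb₀ hab hma).2 ⟨rfl, hm a⟩
  · rintro ⟨j, a'⟩ ⟨hm', hab', hiso'⟩
    obtain ⟨rfl, ha'⟩ := (twistedCurve_pow_isIsomorphicOver_iff hρ ht hb₀ hab hab').1
      (hiso.symm.trans hiso')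
    exact Prod.ext rfl (hm'.symm.trans (hconst _ _ ha'))

end Family

/-! ### Counting the isomorphism classes. -/

section Counting

/-- The parameters of the family, with one parameter `a` for each set `{a, ρ a, ρ² a}`. -/
abbrev FamilyIndex (b₀ : F) (m : F → F) : Type _ :=
  {p : Fin 3 × F // m p.2 = p.2 ∧ ¬ ∃ x : F, x ^ 3 = p.2 ^ 3 - 27 * b₀ ^ (p.1 : ℕ)}

/-- For `a = 0` the condition says that `-27b₀^i`, equivalently `b₀^i`, is not a cube, which leaves
`i = 1, 2`. -/
lemma natCard_familyIndex_zero {b₀ : F} (hb₀ : ¬ ∃ x : F, x ^ 3 = b₀) {m : F → F}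
    (hm0 : m 0 = 0) (h3 : (3 : F) ≠ 0) :
    Nat.card {p : FamilyIndex b₀ m // p.1.2 = 0} = 2 := by
  have h0 : b₀ ≠ 0 := by
    rintro rfl
    exact hb₀ ⟨0, by norm_num⟩
  have hcube : ∀ i : Fin 3, i ≠ 0 → ¬ ∃ x : F, x ^ 3 = 0 ^ 3 - 27 * b₀ ^ (i : ℕ) := by
    rintro i hi ⟨x, hx⟩
    refine hi (eq_of_pow_eq_cube_mul_pow hb₀ (i := i) (j := 0) (w := -3 / x) ?_)
    have hx0 : x ≠ 0 := by
      rintro rfl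
      have : 3 ^ 3 * b₀ ^ (i : ℕ) = 0 := by linear_combination hx
      simp [h3, h0] at this
    simp only [Fin.val_zero, pow_zero]
    field_simp
    linear_combination hx
  rw [← Nat.card_fin 2]
  refine Nat.card_congr (Equiv.ofBijective (fun k : Fin 2 =>
    (⟨⟨(k.succ, 0), hm0, hcube _ (Fin.succ_ne_zero k)⟩, rfl⟩ :
      {p : FamilyIndex b₀ m // p.1.2 = 0})) ⟨fun k l h => ?_, ?_⟩).symm
  · have := congrArg (fun p => p.1.1.1) h
    exact Fin.succ_injective _ this
  · rintro ⟨⟨⟨i, a⟩, ha, hab⟩, h⟩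
    obtain rfl : a = 0 := h
    have hi : i ≠ 0 := by
      rintro rfl
      exact hab ⟨-3, by norm_num⟩
    obtain ⟨k, rfl⟩ := Fin.exists_succ_eq.2 hi
    exact ⟨k, rfl⟩

/-- Dividing by `a³` turns the condition into `1 - 27b₀^i/a³` being a non-cube. This value
determines `i` through the class of `b₀^i/a³` modulo cubes, then `a³`, then the representative `a`.
-/
lemma natCard_familyIndex_ne_zero [Finite F] {ρ : F} (hρ : IsPrimitiveRoot ρ 3) {b₀ : F}
    (hb₀ : ¬ ∃ x : F, x ^ 3 = b₀) {m : F → F} (hm : ∀ a, (m a) ^ 3 = a ^ 3)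
    (hm' : ∀ a a', a ^ 3 = a' ^ 3 → m a = m a') :
    Nat.card {p : FamilyIndex b₀ m // p.1.2 ≠ 0} = Nat.card {y : F // ¬ ∃ x : F, x ^ 3 = y} := by
  have h3 := hρ.three_ne_zero
  have h27 : (27 : F) ≠ 0 := by
    rw [show (27 : F) = 3 ^ 3 by norm_num]
    exact pow_ne_zero 3 h3
  have h0 : b₀ ≠ 0 := by
    rintro rfl
    exact hb₀ ⟨0, by norm_num⟩
  refine Nat.card_congr (Equiv.ofBijective (fun p : {p : FamilyIndex b₀ m // p.1.2 ≠ 0} =>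
    (⟨1 - 27 * b₀ ^ (p.1.1.1 : ℕ) / p.1.1.2 ^ 3, ?_⟩ : {y : F // ¬ ∃ x : F, x ^ 3 = y})) ⟨?_, ?_⟩)
  · obtain ⟨⟨⟨i, a⟩, ha, hab⟩, h : a ≠ 0⟩ := p
    rintro ⟨x, hx⟩
    refine hab ⟨x * a, ?_⟩
    dsimp only at hx ⊢
    rw [mul_pow, hx]
    field_simp
  · rintro ⟨⟨⟨i, a⟩, ha, hab⟩, h⟩ ⟨⟨⟨j, a'⟩, ha', hab'⟩, h'⟩ heq
    change a ≠ 0 at h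
    change a' ≠ 0 at h'
    change m a = a at ha
    change m a' = a' at ha'
    have h1 : 1 - 27 * b₀ ^ (i : ℕ) / a ^ 3 = 1 - 27 * b₀ ^ (j : ℕ) / a' ^ 3 :=
      congrArg Subtype.val heq
    have h2 : b₀ ^ (i : ℕ) * a' ^ 3 = b₀ ^ (j : ℕ) * a ^ 3 := by
      rw [sub_right_inj, div_eq_div_iff (pow_ne_zero 3 h) (pow_ne_zero 3 h')] at h1
      refine mul_left_cancel₀ h27 ?_
      linear_combination h1
    obtain rfl : i = j := eq_of_pow_eq_cube_mul_pow hb₀ (w := a' / a) (by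
      field_simp
      linear_combination -h2)
    have h4 : a' ^ 3 = a ^ 3 := mul_left_cancel₀ (pow_ne_zero _ h0) h2
    obtain rfl : a = a' := by rw [← ha, ← ha', hm' _ _ h4.symm]
    rfl
  · rintro ⟨y, hy⟩
    -- A non-cube `y` differs from `1`, so `(1 - y)/27` can be written `s³b₀^i`, and `a` is the
    -- representative of `s⁻¹`.
    have hy1 : 1 - y ≠ 0 := fun h => hy ⟨1, by rw [one_pow]; linear_combination h⟩
    obtain ⟨i, s, hs, hys⟩ := exists_eq_cube_mul_pow hb₀ (div_ne_zero hy1 h27)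
    have hm3 : m s⁻¹ ^ 3 = (s ^ 3)⁻¹ := by rw [hm, inv_pow]
    have hms : m s⁻¹ ≠ 0 := by
      intro h
      rw [h, zero_pow (by norm_num)] at hm3
      exact inv_ne_zero (pow_ne_zero 3 hs) hm3.symm
    have hval : 1 - 27 * b₀ ^ (i : ℕ) / m s⁻¹ ^ 3 = y := by
      rw [hm3, div_inv_eq_mul]
      rw [div_eq_iff h27] at hys
      linear_combination hys
    refine ⟨⟨⟨(i, m s⁻¹), hm' _ _ (hm _), ?_⟩, hms⟩, Subtype.ext hval⟩
    rintro ⟨x, hx⟩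
    refine hy ⟨x / m s⁻¹, ?_⟩
    dsimp only at hx
    rw [div_pow, hx, ← hval, sub_div, div_self (pow_ne_zero 3 hms)]

lemma natCard_quotient_eq [Fintype F] {ρ : F} (hρ : IsPrimitiveRoot ρ 3) {t b₀ : F}
    (ht : ¬ IsSquare t) (hb₀ : ¬ ∃ x : F, x ^ 3 = b₀) {m : F → F}
    (hm : ∀ a, m a = a ∨ m a = ρ * a ∨ m a = ρ ^ 2 * a) (hmρ : ∀ a, m (ρ * a) = m a) :
    Nat.card (Quotient (quadraticThreeSubgroupCurveSetoid F)) = Nat.card (FamilyIndex b₀ m) := by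
  have h0 : b₀ ≠ 0 := by
    rintro rfl
    exact hb₀ ⟨0, by norm_num⟩
  have ht0 : t ≠ 0 := fun h => ht (h ▸ IsSquare.zero)
  have h2 := two_ne_zero_of_not_isSquare ht
  have h3 := hρ.three_ne_zero
  have hcurve : ∀ p : FamilyIndex b₀ m, (twistedCurve t p.1.2 (b₀ ^ (p.1.1 : ℕ))).IsElliptic ∧
      (twistedCurve t p.1.2 (b₀ ^ (p.1.1 : ℕ))).HasOnlyQuadraticThreeSubgroup := fun p =>
    ⟨isElliptic_twistedCurve h2 h3 ht0 (pow_ne_zero _ h0) p.2.2,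
      hasOnlyQuadraticThreeSubgroup_twistedCurve h3 ht (pow_ne_zero _ h0) p.2.2⟩
  refine (Nat.card_congr (Equiv.ofBijective (fun p : FamilyIndex b₀ m =>
    (⟦⟨_, hcurve p⟩⟧ : Quotient (quadraticThreeSubgroupCurveSetoid F))) ⟨fun p p' h => ?_,
      fun Q => ?_⟩)).symm
  · have hiso : (twistedCurve t p.1.2 (b₀ ^ (p.1.1 : ℕ))).IsIsomorphicOver
      (twistedCurve t p'.1.2 (b₀ ^ (p'.1.1 : ℕ))) := Quotient.exact h
    obtain ⟨q, -, hq⟩ := existsUnique_isIsomorphicOver_twistedCurve_pow hρ ht hb₀ hm hmρ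
      (hcurve p).1 (hcurve p).2
    exact Subtype.ext ((hq p.1 ⟨p.2.1, p.2.2, 1, one_smul _ _⟩).trans
      (hq p'.1 ⟨p'.2.1, p'.2.2, hiso⟩).symm)
  · obtain ⟨E, rfl⟩ := Quotient.exists_rep Q
    obtain ⟨p, ⟨hp, hp', hiso⟩, -⟩ := existsUnique_isIsomorphicOver_twistedCurve_pow hρ ht hb₀
      hm hmρ E.2.1 E.2.2
    exact ⟨⟨p, hp, hp'⟩, Quotient.sound hiso.symm⟩

theorem three_mul_natCard_quotient [Fintype F] {ρ : F} (hρ : IsPrimitiveRoot ρ 3) {t b₀ : F}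
    (ht : ¬ IsSquare t) (hb₀ : ¬ ∃ x : F, x ^ 3 = b₀) :
    3 * Nat.card (Quotient (quadraticThreeSubgroupCurveSetoid F)) = 2 * Fintype.card F + 4 := by
  classical
  -- The sets `{a, ρa, ρ²a}` are the fibres of cubing, so a section of `a ↦ a³` provides
  -- representatives.
  obtain ⟨m, hm, hm'⟩ : ∃ m : F → F, (∀ a, m a ^ 3 = a ^ 3) ∧
      ∀ a a', a ^ 3 = a' ^ 3 → m a = m a' := by
    have hsurj : ∀ y : Set.range fun a : F => a ^ 3, ∃ a, a ^ 3 = (y : F) := fun y => y.2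
    choose r hr using hsurj
    exact ⟨fun a => r ⟨a ^ 3, a, rfl⟩, fun a => hr _,
      fun a a' h => congrArg r (Subtype.ext h)⟩
  have hm0 : m 0 = 0 := by
    have := hm 0
    simpa using this
  rw [natCard_quotient_eq hρ ht hb₀ (fun a => hρ.cube_eq_cube_iff.1 (hm a))
    (fun a => hm' _ _ (hρ.cube_eq_cube_iff.2 (Or.inr (Or.inl rfl)))),
    Nat.card_congr (Equiv.sumCompl fun p : FamilyIndex b₀ m => p.1.2 = 0).symm, Nat.card_sum,
    natCard_familyIndex_zero hb₀ hm0 hρ.three_ne_zero, natCard_familyIndex_ne_zero hρ hb₀ hm hm']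
  have := three_mul_natCard_not_cube hρ
  omega

end Counting

end WeierstrassCurve

theorem mainTheorem7 {F : Type*} [Field F] [Fintype F] (hq : Fintype.card F % 3 = 1)
    (t : F) (ht : ¬ IsSquare t)
    (b₀ : F) (hb₀ : ¬ ∃ x : F, x ^ 3 = b₀)
    (ρ : F) (hρ : IsPrimitiveRoot ρ 3) :
    -- the number of isomorphism classes is `(2 q + 4) / 3`
    3 * Nat.card (Quotient (WeierstrassCurve.quadraticThreeSubgroupCurveSetoid F)) =
        2 * Fintype.card F + 4 ∧
    -- the members of the family are twists of curves with cyclic rational 3-torsion, and they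
    -- have the required property
    (∀ (i : Fin 3) (a : F), (¬ ∃ x : F, x ^ 3 = a ^ 3 - 27 * b₀ ^ (i : ℕ)) →
      (WeierstrassCurve.threePointCurve a (b₀ ^ (i : ℕ))).IsElliptic ∧
      Nat.card (WeierstrassCurve.threePointCurve a (b₀ ^ (i : ℕ))).rationalThreeTorsion = 3 ∧
      (WeierstrassCurve.threePointCurve a (b₀ ^ (i : ℕ))).IsIsomorphicOver
        (WeierstrassCurve.shortCurve (WeierstrassCurve.coeffA a (b₀ ^ (i : ℕ)))
          (WeierstrassCurve.coeffB a (b₀ ^ (i : ℕ)))) ∧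
      (WeierstrassCurve.twistedCurve t a (b₀ ^ (i : ℕ))).IsElliptic ∧
      (WeierstrassCurve.twistedCurve t a (b₀ ^ (i : ℕ))).HasOnlyQuadraticThreeSubgroup) ∧
    -- isomorphisms between members of the family
    (∀ (i j : Fin 3) (a a' : F), (¬ ∃ x : F, x ^ 3 = a ^ 3 - 27 * b₀ ^ (i : ℕ)) →
      (¬ ∃ x : F, x ^ 3 = a' ^ 3 - 27 * b₀ ^ (j : ℕ)) →
      ((WeierstrassCurve.twistedCurve t a (b₀ ^ (i : ℕ))).IsIsomorphicOver
          (WeierstrassCurve.twistedCurve t a' (b₀ ^ (j : ℕ))) ↔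
        i = j ∧ (a' = a ∨ a' = ρ * a ∨ a' = ρ ^ 2 * a))) ∧
    -- choosing one element `m a` in each set `{a, ρ a, ρ² a}` gives exactly one member in each
    -- isomorphism class
    (∀ m : F → F, (∀ a, m a = a ∨ m a = ρ * a ∨ m a = ρ ^ 2 * a) → (∀ a, m (ρ * a) = m a) →
      ∀ E : WeierstrassCurve F, E.IsElliptic → E.HasOnlyQuadraticThreeSubgroup →
        ∃! p : Fin 3 × F, m p.2 = p.2 ∧
          (¬ ∃ x : F, x ^ 3 = p.2 ^ 3 - 27 * b₀ ^ (p.1 : ℕ)) ∧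
          E.IsIsomorphicOver (WeierstrassCurve.twistedCurve t p.2 (b₀ ^ (p.1 : ℕ)))) := by
  have h0 : b₀ ≠ 0 := by
    rintro rfl
    exact hb₀ ⟨0, by norm_num⟩
  have ht0 : t ≠ 0 := fun h => ht (h ▸ IsSquare.zero)
  have h2 := WeierstrassCurve.two_ne_zero_of_not_isSquare ht
  have h3 := hρ.three_ne_zero
  refine ⟨WeierstrassCurve.three_mul_natCard_quotient hρ ht hb₀, fun i a hab => ?_,
    fun i j a a' hab hab' =>
      WeierstrassCurve.twistedCurve_pow_isIsomorphicOver_iff hρ ht hb₀ hab hab',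
    fun m hm hmρ E hE h =>
      WeierstrassCurve.existsUnique_isIsomorphicOver_twistedCurve_pow hρ ht hb₀ hm hmρ hE h⟩
  have hb : b₀ ^ (i : ℕ) ≠ 0 := pow_ne_zero _ h0
  exact ⟨WeierstrassCurve.isElliptic_threePointCurve hb hab,
    WeierstrassCurve.natCard_rationalThreeTorsion_threePointCurve h3 hb hab,
    WeierstrassCurve.threePointCurve_isIsomorphicOver_shortCurve h2 h3 _ _,
    WeierstrassCurve.isElliptic_twistedCurve h2 h3 ht0 hb hab,
    WeierstrassCurve.hasOnlyQuadraticThreeSubgroup_twistedCurve h3 ht hb hab⟩
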